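/- Let $p$ be an odd prime, let $m,s$ be positive integers, and let $\mathcal R=\mathbb F_{p^m}[u,v]/\langle u^2,v^2,uv-vu\rangle$. Let $\alpha=\alpha_1+\alpha_2u+\alpha_3v+\alpha_4uv\in\mathcal R$ with $\alpha_1,\alpha_2,\alpha_3\in\mathbb F_{p^m}^{*}$ and $\alpha_4\in\mathbb F_{p^m}$, and assume that $\alpha$ is not a square in $\mathcal R$. Let $\alpha_0=\alpha_1^{p^{m-r_0}}$, where $r_0$ is the remainder of $s$ modulo $m$ (so that $\alpha_0^{p^s}=\alpha_1$), and let $\mathcal R_\alpha=\mathcal R[x]/\langle x^{2p^s}-\alpha\rangle$. An ideal of $\mathcal R_\alpha$ is identified with the code of length $2p^s$ over $\mathcal R$ that consists of the coefficient vectors $(c_0,\dots,c_{2p^s-1})$ of its elements $c_0+c_1x+\dots+c_{2p^s-1}x^{2p^s-1}$. For a code $\mathcal C$ of length $n$ the symbol-pair distance is $d_{sp}(\mathcal C)=\min_{a\ne b\in\mathcal C}|\{i : (a_i,a_{i+1})\neq(b_i,b_{i+1})\}|$, with indices modulo $n$. Let $0\le \ell\le 2p^s-1$ and $0\le t<\ell$,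 let $z(x)\in\mathcal R_\alpha$ be $0$ or a unit, and let $\Im$ be the smallest integer $k\ge 0$ with $u(x^2-\alpha_0)^{k}\in\langle (x^2-\alpha_0)^\ell+u(x^2-\alpha_0)^tz(x)\rangle$. Let $0\le\mu\le\Im$ and $$\mathcal C=\langle (x^2-\alpha_0)^\ell+u(x^2-\alpha_0)^tz(x),\ u(x^2-\alpha_0)^\mu\rangle\subseteq\mathcal R_\alpha .$$ Then $d_{sp}(\mathcal C)=d_{sp}(\langle u(x^2-\alpha_0)^\mu\rangle)$, and $$d_{sp}(\mathcal C)=\begin{cases}2 & \text{if } 0\le\mu\le p^s;\\ 2(\Gamma+1)p^\gamma & \text{if } 2p^s-p^{s-\gamma}+(\Gamma-1)p^{s-\gamma-1}+1\le\mu\le 2p^s-p^{s-\gamma}+\Gamma p^{s-\gamma-1},\\ & \text{where } 1\le\Gamma\le p-1 \text{ and } 0\le\gamma\le s-1.\end{cases}$$ -/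

import Mathlib

open Polynomial

noncomputable section

namespace PairCode

/-! ### Symbol-pair distance -/

/-- The cyclic successor `i + 1 mod n` of a position `i` of a word of length `n`. -/
def next {n : ℕ} (i : Fin n) : Fin n :=
  ⟨(i.1 + 1) % n, Nat.mod_lt _ (lt_of_le_of_lt (Nat.zero_le _) i.2)⟩

/-- The symbol-pair distance `|{i : (x_i, x_{i+1}) ≠ (y_i, y_{i+1})}|` of two words,
indices being read modulo `n`. -/
def pairDist {A : Type*} {n : ℕ} (x y : Fin n → A) : ℕ :=
  Set.ncard {i : Fin n | (x i, x (next i)) ≠ (y i, y (next i))}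

/-- The symbol-pair distance of a code: the minimum of the distances of two distinct codewords
(and `0` for a code with at most one word). -/
def codePairDist {A : Type*} {n : ℕ} (C : Set (Fin n → A)) : ℕ :=
  sInf {d : ℕ | ∃ x ∈ C, ∃ y ∈ C, x ≠ y ∧ d = pairDist x y}

/-! ### Constacyclic codes -/

/-- The ring `R[x] / ⟨x ^ n - a⟩`, whose ideals are the `a`-constacyclic codes of length `n`. -/
abbrev Ambient {R : Type*} [CommRing R] (n : ℕ) (a : R) : Type _ :=
  AdjoinRoot (X ^ n - C a : R[X])

/-- The class of `x` in `R[x] / ⟨x ^ n - a⟩`. -/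
abbrev xbar {R : Type*} [CommRing R] (n : ℕ) (a : R) : Ambient n a :=
  AdjoinRoot.root (X ^ n - C a : R[X])

/-- The constant `r` in `R[x] / ⟨x ^ n - a⟩`. -/
abbrev const {R : Type*} [CommRing R] (n : ℕ) (a r : R) : Ambient n a :=
  AdjoinRoot.of (X ^ n - C a : R[X]) r

/-- The code of an ideal `I` of `R[x] / ⟨x ^ n - a⟩`: the words `(c_0, …, c_{n-1})` such that
the class of `c_0 + c_1 x + ⋯ + c_{n-1} x ^ (n-1)` lies in `I`. -/
def codeOf {R : Type*} [CommRing R] {n : ℕ} {a : R} (I : Ideal (Ambient n a)) :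
    Set (Fin n → R) :=
  {c | ∑ i : Fin n, const n a (c i) * xbar n a ^ (i : ℕ) ∈ I}

/-! ### The ring `F[u, v] / ⟨u², v², uv - vu⟩` -/

/-- The ring `F[u, v] / ⟨u², v², uv - vu⟩ = F + uF + vF + uvF`. -/
abbrev Ruv (F : Type*) [Field F] : Type _ :=
  MvPolynomial (Fin 2) F ⧸
    (Ideal.span {MvPolynomial.X 0 ^ 2, MvPolynomial.X 1 ^ 2,
      MvPolynomial.X 0 * MvPolynomial.X 1 - MvPolynomial.X 1 * MvPolynomial.X 0} :
        Ideal (MvPolynomial (Fin 2) F))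

/-- The element `u`. -/
def u (F : Type*) [Field F] : Ruv F := Ideal.Quotient.mk _ (MvPolynomial.X 0)

/-- The element `v`. -/
def v (F : Type*) [Field F] : Ruv F := Ideal.Quotient.mk _ (MvPolynomial.X 1)

/-- The element `α₁ + α₂ u + α₃ v + α₄ uv`. -/
def elt {F : Type*} [Field F] (α₁ α₂ α₃ α₄ : F) : Ruv F :=
  algebraMap F (Ruv F) α₁ + algebraMap F (Ruv F) α₂ * u F
    + algebraMap F (Ruv F) α₃ * v F + algebraMap F (Ruv F) α₄ * (u F * v F)

/-! ### The codes of length `2 p ^ s` -/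

/-- `α₀ = α₁ ^ (p ^ (m - r₀))`, where `r₀` is the remainder of `s` modulo `m`; over a field with
`p ^ m` elements it satisfies `α₀ ^ (p ^ s) = α₁`. -/
def alpha0 {F : Type*} [Field F] (p m s : ℕ) (α₁ : F) : F := α₁ ^ p ^ (m - s % m)

variable {F : Type*} [Field F] {n : ℕ} {a : Ruv F}

/-- The element `x ^ 2 - α₀` of `R[x] / ⟨x ^ n - a⟩`. -/
def w (n : ℕ) (a : Ruv F) (α₀ : F) : Ambient n a :=
  xbar n a ^ 2 - const n a (algebraMap F (Ruv F) α₀)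

/-- The element `u (x ^ 2 - α₀) ^ k`. -/
def uw (n : ℕ) (a : Ruv F) (α₀ : F) (k : ℕ) : Ambient n a := const n a (u F) * w n a α₀ ^ k

/-- The element `(x ^ 2 - α₀) ^ ℓ + u (x ^ 2 - α₀) ^ t z(x)`. -/
def gen (α₀ : F) (ℓ t : ℕ) (z : Ambient n a) : Ambient n a :=
  w n a α₀ ^ ℓ + uw n a α₀ t * z

/-- The smallest `k` with `u (x ^ 2 - α₀) ^ k ∈ ⟨(x ^ 2 - α₀) ^ ℓ + u (x ^ 2 - α₀) ^ t z(x)⟩`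
(there is one: `k = ℓ` belongs to the set, because `u ^ 2 = 0`). -/
def torIndex (α₀ : F) (ℓ t : ℕ) (z : Ambient n a) : ℕ :=
  sInf {k : ℕ | uw n a α₀ k ∈ Ideal.span {gen α₀ ℓ t z}}

/-- `⟨(x ^ 2 - α₀) ^ ℓ + u (x ^ 2 - α₀) ^ t z(x), u (x ^ 2 - α₀) ^ μ⟩`. -/
def typeD (α₀ : F) (ℓ t μ : ℕ) (z : Ambient n a) : Ideal (Ambient n a) :=
  Ideal.span {gen α₀ ℓ t z, uw n a α₀ μ}

end PairCode

end

/-! ### Blocks of coefficients -/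

/-! Write `w` for the class of x² - α₀ and q = p^s. Since α₀^q = α₁, one gets w^q = α₂u + α₃v +
α₄uv, hence u w^q = α₃uv and u w^(2q) = 0. As α is not a square, x² - α₀ is irreducible over F, and
the ambient ring is local with maximal ideal ⟨u, w⟩ (v is redundant because α₃ ≠ 0). So every
nonzero multiple of u is u w^k times a unit (`Relations.u_mul_eq`).

Reduction to ⟨u w^μ⟩: let c be a nonzero codeword of C. If uc ≠ 0, then uc lies in ⟨u w^ℓ⟩ ⊆ ⟨u w^μ⟩
and has no larger pair weight. If uc = 0, minimality of the torsion index forces c itself into ⟨u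
w^μ⟩ (`Relations.codePairDist_typeD`).

Distance of ⟨u w^μ⟩: for μ ≤ q it contains the constant uv, of pair weight 2. For μ = q + j its
words are uv·g with g over F divisible by (x² - α₀)^j. The even and odd parts of g are, in the
variable x², divisible by (x - α₀)^j; positions of equal parity are never adjacent, so the pair
distance is twice the Hamming distance of the repeated-root code ⟨(x - α₀)^j⟩ of length p^s. That
distance is bounded below by peeling off one factor p of the length at a time
(`exists_lower_block`), and above by an explicit power of x - α₀. -/

namespace Polynomial

section Block

variable {K : Type*} [Field K]

/-- The polynomial formed by the coefficients of `f` in the positions `r, q + r, 2 q + r, …`. -/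
noncomputable def block (q r : ℕ) (f : K[X]) : K[X] := contract q (divX^[r] f)

theorem coeff_iterate_divX (r n : ℕ) (f : K[X]) : (divX^[r] f).coeff n = f.coeff (n + r) := by
  induction r generalizing n with
  | zero => rfl
  | succ r ih =>
    rw [Function.iterate_succ_apply', coeff_divX, ih]
    congr 1
    omega

theorem coeff_block {q : ℕ} (hq : q ≠ 0) (r n : ℕ) (f : K[X]) :
    (block q r f).coeff n = f.coeff (n * q + r) := by
  rw [block, coeff_contract hq, coeff_iterate_divX]

theorem coeff_sum_X_pow_mul_expand {q : ℕ} (hq : 0 < q) (g : ℕ → K[X]) {r : ℕ} (hr : r < q)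
    (n : ℕ) :
    (∑ i ∈ Finset.range q, X ^ i * expand K q (g i)).coeff (n * q + r) = (g r).coeff n := by
  rw [finsetSum_coeff, Finset.sum_eq_single r]
  · rw [coeff_X_pow_mul', if_pos (by omega), Nat.add_sub_cancel, coeff_expand_mul hq]
  · intro i hi hir
    rw [Finset.mem_range] at hi
    rw [coeff_X_pow_mul']
    split_ifs with h
    · rw [coeff_expand hq, if_neg]
      intro hd
      have : (n * q + r) % q = i % q := ((Nat.modEq_iff_dvd' h).2 hd).symm
      rw [Nat.mul_comm, Nat.mul_add_mod, Nat.mod_eq_of_lt hr, Nat.mod_eq_of_lt hi] at this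
      exact hir this.symm
    · rfl
  · intro h
    exact absurd (Finset.mem_range.2 hr) h

theorem block_sum_X_pow_mul_expand {q : ℕ} (hq : 0 < q) (g : ℕ → K[X]) {r : ℕ} (hr : r < q) :
    block q r (∑ i ∈ Finset.range q, X ^ i * expand K q (g i)) = g r := by
  ext n
  rw [coeff_block hq.ne', coeff_sum_X_pow_mul_expand hq g hr]

theorem sum_X_pow_mul_expand_block {q : ℕ} (hq : 0 < q) (f : K[X]) :
    ∑ r ∈ Finset.range q, X ^ r * expand K q (block q r f) = f := by
  ext n
  have h := coeff_sum_X_pow_mul_expand hq (fun r => block q r f) (Nat.mod_lt n hq) (n / q)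
  rw [coeff_block hq.ne', Nat.div_add_mod' n q] at h
  exact h

/-- Multiplication by a polynomial in X^q acts on each residue class of exponents separately. -/
theorem dvd_block_of_expand_dvd {q : ℕ} (hq : 0 < q) {P f : K[X]} (h : expand K q P ∣ f) {r : ℕ}
    (hr : r < q) : P ∣ block q r f := by
  obtain ⟨k, rfl⟩ := h
  have : expand K q P * k =
      ∑ i ∈ Finset.range q, X ^ i * expand K q (P * block q i k) := by
    conv_lhs => rw [← sum_X_pow_mul_expand_block hq k]
    rw [Finset.mul_sum]
    refine Finset.sum_congr rfl fun i _ => ?_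
    rw [map_mul]
    ring
  rw [this, block_sum_X_pow_mul_expand hq _ hr]
  exact dvd_mul_right _ _

theorem exists_block_ne_zero {q : ℕ} (hq : 0 < q) {f : K[X]} (hf : f ≠ 0) :
    ∃ r < q, block q r f ≠ 0 := by
  by_contra! h
  apply hf
  rw [← sum_X_pow_mul_expand_block hq f]
  refine Finset.sum_eq_zero fun r hr => ?_
  rw [h r (Finset.mem_range.1 hr), map_zero, mul_zero]

theorem natDegree_block_lt {q d r : ℕ} (hq : 0 < q) (hd : 0 < d) {f : K[X]}
    (hf : f.natDegree < d * q) : (block q r f).natDegree < d := by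
  refine (Nat.lt_iff_le_pred hd).2 (natDegree_le_iff_coeff_eq_zero.2 fun n hn => ?_)
  rw [coeff_block hq.ne']
  apply coeff_eq_zero_of_natDegree_lt
  have : d * q ≤ n * q := Nat.mul_le_mul_right _ (by omega)
  omega

theorem sum_card_support_block_le {q : ℕ} (hq : 0 < q) (f : K[X]) :
    ∑ r ∈ Finset.range q, (block q r f).support.card ≤ f.support.card := by
  rw [Finset.card_eq_sum_card_fiberwise (f := fun n => n % q) (t := Finset.range q)
    (fun n _ => by simpa using Nat.mod_lt n hq)]
  refine Finset.sum_le_sum fun r hr => ?_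
  rw [Finset.mem_range] at hr
  refine Finset.card_le_card_of_injOn (fun n => n * q + r) ?_ ?_
  · intro n hn
    simp only [Finset.mem_coe, mem_support_iff, coeff_block hq.ne'] at hn
    simp only [Finset.coe_filter, mem_support_iff, Set.mem_ofPred_eq]
    exact ⟨hn, by rw [Nat.mul_comm, Nat.mul_add_mod, Nat.mod_eq_of_lt hr]⟩
  · intro n _ k _ h
    exact Nat.eq_of_mul_eq_mul_right hq (Nat.add_right_cancel h)

end Block

/-! ### The weight of a polynomial with a multiple root -/

section Weight

variable {K : Type*} [Field K] {p : ℕ}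

theorem eq_zero_of_X_sub_C_dvd_of_card_support_le_one {a : K} (ha : a ≠ 0) {f : K[X]}
    (h : X - C a ∣ f) (hf : f.support.card ≤ 1) : f = 0 := by
  obtain ⟨n, c, rfl⟩ := card_support_le_one_iff_monomial.1 hf
  rw [dvd_iff_isRoot, IsRoot.def, eval_monomial] at h
  rw [(mul_eq_zero.1 h).resolve_right (pow_ne_zero _ ha), monomial_zero_right]

/-- The operator f ↦ X f' - d f, with d the degree of f, kills the leading term, creates no new one,
and lowers the multiplicity of the root a by at most one. Degree below p keeps n - d nonzero in K
for every other exponent n. -/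
theorem lt_card_support_of_X_sub_C_pow_dvd [CharP K p] {a : K} (ha : a ≠ 0)
    {i : ℕ} {f : K[X]} (hf : f ≠ 0) (hd : f.natDegree < p) (h : (X - C a) ^ i ∣ f) :
    i < f.support.card := by
  induction i generalizing f with
  | zero => exact Finset.card_pos.2 (nonempty_support_iff.2 hf)
  | succ i ih =>
    set d := f.natDegree with hdd
    set g : K[X] := X * derivative f - C (d : K) * f with hg
    have hcoeff : ∀ n, g.coeff n = ((n : K) - d) * f.coeff n := by
      intro n
      rw [hg, coeff_sub, coeff_C_mul]
      cases n with
      | zero => simp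
      | succ n => rw [coeff_X_mul, coeff_derivative]; push_cast; ring
    have hsub : g.support ⊆ f.support.erase d := by
      intro n hn
      rw [mem_support_iff, hcoeff] at hn
      rw [Finset.mem_erase, mem_support_iff]
      refine ⟨?_, right_ne_zero_of_mul hn⟩
      rintro rfl
      simp at hn
    have hdmem : d ∈ f.support := natDegree_mem_support_of_nonzero hf
    have hcard : g.support.card + 1 ≤ f.support.card := by
      have := Finset.card_le_card hsub
      rw [Finset.card_erase_of_mem hdmem] at this
      have := Finset.card_pos.2 ⟨d, hdmem⟩
      omega
    have hg0 : g ≠ 0 := by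
      intro h0
      refine hf (eq_zero_of_X_sub_C_dvd_of_card_support_le_one ha
        ((dvd_pow_self _ (Nat.succ_ne_zero i)).trans h) ?_)
      rw [← Finset.card_singleton d]
      refine Finset.card_le_card fun n hn => ?_
      have h1 := hcoeff n
      rw [h0, coeff_zero, zero_eq_mul] at h1
      have h2 := h1.resolve_right (mem_support_iff.1 hn)
      rw [sub_eq_zero, CharP.natCast_eq_natCast K p] at h2
      rw [Finset.mem_singleton]
      exact Nat.ModEq.eq_of_lt_of_lt h2 ((le_natDegree_of_mem_supp n hn).trans_lt hd) hd
    have hgd : g.natDegree < p := by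
      refine lt_of_le_of_lt (natDegree_le_iff_coeff_eq_zero.2 fun n hn => ?_) hd
      rw [hcoeff, coeff_eq_zero_of_natDegree_lt hn, mul_zero]
    have hdvd : (X - C a) ^ i ∣ g := by
      refine dvd_sub (Dvd.dvd.mul_left ?_ _)
        (Dvd.dvd.mul_left ((pow_dvd_pow _ (Nat.le_succ i)).trans h) _)
      obtain ⟨k, hk⟩ := h
      rw [hk, derivative_mul, derivative_X_sub_C_pow]
      exact dvd_add (Dvd.intro_left _ rfl |>.mul_right _)
        (Dvd.dvd.mul_right (pow_dvd_pow _ (Nat.le_succ i)) _)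
    have := ih hg0 hgd hdvd
    omega

/-- With q = p^k, X^q - a^q = (X - a)^q. If i is the common multiplicity of a^q in the blocks of f,
then f = (X - a)^(qi) h', and g is the remainder of h' modulo (X - a)^q. Each nonzero coefficient of
g marks a block of weight at least i + 1. -/
theorem exists_lower_block [Fact p.Prime] [CharP K p] {a : K} (ha : a ≠ 0) {k j : ℕ} {f : K[X]}
    (hf : f ≠ 0) (hd : f.natDegree < p * p ^ k) (h : (X - C a) ^ j ∣ f) :
    ∃ (i : ℕ) (g : K[X]), i < p ∧ g ≠ 0 ∧ g.natDegree < p ^ k ∧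
      (X - C a) ^ (j - p ^ k * i) ∣ g ∧ (i + 1) * g.support.card ≤ f.support.card := by
  classical
  have hp : p.Prime := Fact.out
  set q := p ^ k with hqk
  have hq : 0 < q := pow_pos hp.pos k
  set b := a ^ q with hb
  have hb0 : b ≠ 0 := pow_ne_zero _ ha
  have hexp : expand K q (X - C b) = (X - C a) ^ q := by
    rw [map_sub, expand_X, expand_C, sub_pow_char_pow, hb, C_pow]
  have hdeg : ∀ r, (block q r f).natDegree < p := fun r => natDegree_block_lt hq hp.pos hd
  have hlt : ∀ r i, block q r f ≠ 0 → (X - C b) ^ i ∣ block q r f →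
      i < (block q r f).support.card :=
    fun r i h0 h1 => lt_card_support_of_X_sub_C_pow_dvd hb0 h0 (hdeg r) h1
  have hle : ∀ r i, block q r f ≠ 0 → (X - C b) ^ i ∣ block q r f → i < p := by
    intro r i h0 h1
    refine lt_of_le_of_lt ?_ (hdeg r)
    simpa using natDegree_le_of_dvd h1 h0
  obtain ⟨r₀, hr₀, hr₀'⟩ := exists_block_ne_zero hq hf
  -- The least such i is the largest power of X - b dividing every block; degrees below p bound it.
  have hex : ∃ i, ∃ r < q, ¬ (X - C b) ^ (i + 1) ∣ block q r f :=
    ⟨p, r₀, hr₀, fun h' => by have := hle _ _ hr₀' h'; omega⟩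
  obtain ⟨r₁, hr₁, hr₁'⟩ := Nat.find_spec hex
  set i := Nat.find hex with hi
  have hall : ∀ r, ∃ c, r < q → block q r f = (X - C b) ^ i * c := by
    intro r
    by_cases hr : r < q
    · by_cases hi0 : i = 0
      · exact ⟨block q r f, fun _ => by rw [hi0, pow_zero, one_mul]⟩
      · have := Nat.find_min hex (m := i - 1) (by omega)
        push Not at this
        have h2 := this r hr
        rw [Nat.sub_add_cancel (by omega)] at h2
        obtain ⟨c, hc⟩ := h2
        exact ⟨c, fun _ => hc⟩
    · exact ⟨0, fun h' => absurd h' hr⟩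
  choose c hc using hall
  have hne : ∀ r < q, (c r).eval b ≠ 0 → block q r f ≠ 0 := by
    intro r hr h0 h1
    have h2 := hc r hr
    rw [h1, zero_eq_mul] at h2
    rw [h2.resolve_left (pow_ne_zero _ (X_sub_C_ne_zero b)), eval_zero] at h0
    exact h0 rfl
  have hr₁e : (c r₁).eval b ≠ 0 := by
    intro h0
    apply hr₁'
    rw [hc r₁ hr₁, pow_succ]
    exact mul_dvd_mul_left _ (dvd_iff_isRoot.2 h0)
  set g : K[X] := ∑ r ∈ Finset.range q, monomial r ((c r).eval b) with hg
  have hgc : ∀ n, g.coeff n = if n < q then (c n).eval b else 0 := by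
    intro n
    simp only [hg, finsetSum_coeff, coeff_monomial, Finset.sum_ite_eq', Finset.mem_range]
  have hg0 : g ≠ 0 := by
    intro h0
    apply hr₁e
    have := hgc r₁
    rw [if_pos hr₁, h0, coeff_zero] at this
    exact this.symm
  have hgd : g.natDegree < q := by
    refine (Nat.lt_iff_le_pred hq).2 (natDegree_le_iff_coeff_eq_zero.2 fun n hn => ?_)
    rw [hgc, if_neg (by omega)]
  set h' : K[X] := ∑ r ∈ Finset.range q, X ^ r * expand K q (c r) with hh'
  have hfh : f = (X - C a) ^ (q * i) * h' := by
    conv_lhs => rw [← sum_X_pow_mul_expand_block hq f]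
    rw [hh', Finset.mul_sum]
    refine Finset.sum_congr rfl fun r hr => ?_
    rw [hc r (Finset.mem_range.1 hr), map_mul, map_pow, hexp, pow_mul]
    ring
  have hhg : (X - C a) ^ q ∣ h' - g := by
    rw [hh', hg, ← Finset.sum_sub_distrib]
    refine Finset.dvd_sum fun r _ => ?_
    have hd' : (X - C a) ^ q ∣ expand K q (c r - C ((c r).eval b)) := by
      obtain ⟨e, he⟩ := X_sub_C_dvd_sub_C_eval (a := b) (p := c r)
      exact ⟨expand K q e, by rw [he, map_mul, hexp]⟩
    have : X ^ r * expand K q (c r) - monomial r ((c r).eval b) =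
        X ^ r * expand K q (c r - C ((c r).eval b)) := by
      rw [map_sub, expand_C, mul_sub, X_pow_mul_C, C_mul_X_pow_eq_monomial]
    rw [this]
    exact hd'.mul_left _
  have hdh : (X - C a) ^ (j - q * i) ∣ h' := by
    rcases le_total j (q * i) with hji | hji
    · rw [Nat.sub_eq_zero_of_le hji, pow_zero]
      exact one_dvd _
    · rw [hfh] at h
      obtain ⟨e, rfl⟩ := Nat.exists_eq_add_of_le hji
      rw [pow_add] at h
      rw [Nat.add_sub_cancel_left]
      exact (mul_dvd_mul_iff_left (pow_ne_zero _ (X_sub_C_ne_zero a))).1 h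
  have hmin : (X - C a) ^ (min (j - q * i) q) ∣ g := by
    have h1 := (pow_dvd_pow (X - C a) (min_le_left (j - q * i) q)).trans hdh
    have h2 := (pow_dvd_pow (X - C a) (min_le_right (j - q * i) q)).trans hhg
    have := dvd_sub h1 h2
    rwa [sub_sub_cancel] at this
  -- A nonzero g of degree below q cannot be divisible by (X - a)^q, so the minimum is j - q * i.
  have hminle : min (j - q * i) q < q := by
    refine lt_of_le_of_lt ?_ hgd
    simpa using natDegree_le_of_dvd hmin hg0
  rw [min_eq_left (by omega)] at hmin
  refine ⟨i, g, hle r₁ i (hne r₁ hr₁ hr₁e) ⟨_, hc r₁ hr₁⟩, hg0, hgd, hmin, ?_⟩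
  have hsub : g.support ⊆ Finset.range q := by
    intro n hn
    rw [mem_support_iff, hgc] at hn
    rw [Finset.mem_range]
    by_contra hcon
    rw [if_neg hcon] at hn
    exact hn rfl
  refine le_trans ?_ (sum_card_support_block_le hq f)
  refine le_trans ?_ (Finset.sum_le_sum_of_subset hsub)
  rw [mul_comm, ← smul_eq_mul]
  refine Finset.card_nsmul_le_sum _ _ _ fun r hr => ?_
  have hrq := Finset.mem_range.1 (hsub hr)
  rw [mem_support_iff, hgc, if_pos hrq] at hr
  exact hlt r i (hne r hrq hr) ⟨_, hc r hrq⟩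

/-- The lower bound for the Hamming distance of the repeated-root constacyclic code
`⟨(X - a) ^ j⟩` of length `p ^ s`. -/
theorem le_card_support_of_X_sub_C_pow_dvd [Fact p.Prime] [CharP K p] {a : K} (ha : a ≠ 0)
    {γ s Γ j : ℕ} {f : K[X]} (hγ : γ < s) (hΓ : 1 ≤ Γ) (hf : f ≠ 0)
    (hd : f.natDegree < p ^ s) (h : (X - C a) ^ j ∣ f)
    (hj : p ^ s + (Γ - 1) * p ^ (s - γ - 1) < j + p ^ (s - γ)) :
    (Γ + 1) * p ^ γ ≤ f.support.card := by
  have hp : p.Prime := Fact.out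
  have hp1 := hp.one_lt
  induction γ generalizing s j f with
  | zero =>
    obtain ⟨k, rfl⟩ : ∃ k, s = k + 1 := ⟨s - 1, by omega⟩
    rw [pow_succ'] at hd
    obtain ⟨i, g, hip, hg0, hgd, hdvd, hle⟩ := exists_lower_block ha hf hd h
    have hcard : 0 < g.support.card := Finset.card_pos.2 (nonempty_support_iff.2 hg0)
    simp only [Nat.sub_zero, Nat.add_sub_cancel] at hj
    rw [pow_zero, mul_one]
    refine le_trans ?_ hle
    have hjlt : j - p ^ k * i < p ^ k := by
      refine lt_of_le_of_lt ?_ hgd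
      simpa using natDegree_le_of_dvd hdvd hg0
    have hq : 0 < p ^ k := pow_pos hp.pos k
    have h1 : Γ - 1 ≤ i := by
      by_contra! hc
      have : p ^ k * (i + 1) ≤ p ^ k * (Γ - 1) := Nat.mul_le_mul_left _ hc
      rw [Nat.mul_succ] at this
      rw [Nat.mul_comm (Γ - 1)] at hj
      omega
    -- If i = Γ - 1, a positive multiplicity is left for g, so g has at least two terms and 2Γ ≥ Γ +
    -- 1; if i ≥ Γ, one term of g is enough.
    rcases Nat.lt_or_ge i Γ with h2 | h2
    · obtain rfl : i = Γ - 1 := by omega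
      have h3 : 2 ≤ g.support.card := by
        by_contra! hc
        refine hg0 (eq_zero_of_X_sub_C_dvd_of_card_support_le_one ha
          ((dvd_pow_self _ ?_).trans hdvd) (by omega))
        rw [Nat.mul_comm (Γ - 1)] at hj
        omega
      calc Γ + 1 ≤ (Γ - 1 + 1) * 2 := by omega
        _ ≤ _ := Nat.mul_le_mul_left _ h3
    · calc Γ + 1 ≤ (i + 1) * 1 := by omega
        _ ≤ _ := Nat.mul_le_mul_left _ hcard
  | succ γ ih =>
    obtain ⟨k, rfl⟩ : ∃ k, s = k + 1 := ⟨s - 1, by omega⟩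
    have hd' := hd
    rw [pow_succ'] at hd'
    obtain ⟨i, g, hip, hg0, hgd, hdvd, hle⟩ := exists_lower_block ha hf hd' h
    have hjlt : j - p ^ k * i < p ^ k := by
      refine lt_of_le_of_lt ?_ hgd
      simpa using natDegree_le_of_dvd hdvd hg0
    have e1 : k + 1 - (γ + 1) = k - γ := by omega
    rw [e1, pow_succ] at hj
    have hq : 0 < p ^ k := pow_pos hp.pos k
    have hpow : p ^ (k - γ) ≤ p ^ k := Nat.pow_le_pow_right hp.pos (by omega)
    -- A smaller i would leave g with multiplicity above p^k, beyond its degree. So the full factor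
    -- p is gained and the induction continues at length p^k.
    have h1 : i = p - 1 := by
      by_contra! hc
      have : p ^ k * (i + 2) ≤ p ^ k * p := Nat.mul_le_mul_left _ (by omega)
      rw [Nat.mul_add] at this
      omega
    subst h1
    have e2 : p ^ k * (p - 1) + p ^ k = p ^ k * p := by
      rw [← Nat.mul_succ]; congr 1; omega
    have := ih (by omega) hg0 hgd hdvd (by omega)
    calc (Γ + 1) * p ^ (γ + 1) = p * ((Γ + 1) * p ^ γ) := by ring
      _ ≤ (p - 1 + 1) * g.support.card := by
        rw [Nat.sub_add_cancel hp.one_lt.le]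
        exact Nat.mul_le_mul_left _ this
      _ ≤ _ := hle

theorem card_support_expand_le {q : ℕ} (hq : 0 < q) (f : K[X]) :
    (expand K q f).support.card ≤ f.support.card := by
  refine Finset.card_le_card_of_injOn (fun n => n / q) ?_ ?_
  · intro n hn
    rw [Finset.mem_coe, mem_support_iff, coeff_expand hq] at hn
    split_ifs at hn with h
    · exact mem_support_iff.2 hn
    · exact absurd rfl hn
  · have hdvd : ∀ n ∈ (expand K q f).support, q ∣ n := by
      intro n hn
      by_contra h
      rw [mem_support_iff, coeff_expand hq, if_neg h] at hn
      exact hn rfl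
    intro n hn k hk h
    exact (Nat.div_left_inj (hdvd n hn) (hdvd k hk)).1 h

theorem card_support_X_sub_C_pow_le (a : K) (n : ℕ) :
    ((X - C a) ^ n).support.card ≤ n + 1 := by
  have := card_supp_le_succ_natDegree ((X - C a) ^ n)
  simpa using this

/-- A word of weight at most `(Γ + 1) p ^ γ` in a repeated-root constacyclic code. -/
theorem card_support_X_sub_C_pow_le_mul [Fact p.Prime] [CharP K p] (a : K) {γ s Γ : ℕ}
    (hγ : γ < s) :
    ((X - C a) ^ (p ^ s - p ^ (s - γ) + Γ * p ^ (s - γ - 1))).support.card ≤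
      (Γ + 1) * p ^ γ := by
  have hp : p.Prime := Fact.out
  obtain ⟨k, rfl⟩ : ∃ k, s = k + 1 + γ := ⟨s - γ - 1, by omega⟩
  have hexp : ∀ (l : ℕ) (b : K), expand K (p ^ l) (X - C (b ^ p ^ l)) = (X - C b) ^ p ^ l := by
    intro l b
    rw [map_sub, expand_X, expand_C, sub_pow_char_pow, C_pow]
  -- The power splits into a polynomial of degree p^γ - 1 in X^(p^(k+1)) times one of degree Γ in
  -- X^(p^k), giving at most p^γ and Γ + 1 terms.
  have e : p ^ (k + 1 + γ) - p ^ (k + 1 + γ - γ) + Γ * p ^ (k + 1 + γ - γ - 1) =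
      p ^ (k + 1) * (p ^ γ - 1) + p ^ k * Γ := by
    rw [Nat.add_sub_cancel, Nat.add_sub_cancel, Nat.mul_sub, mul_one, pow_add, Nat.mul_comm Γ]
  rw [e, pow_add, pow_mul, pow_mul, ← hexp, ← hexp, ← map_pow, ← map_pow, mul_comm (Γ + 1)]
  refine card_support_mul_le.trans (Nat.mul_le_mul ?_ ?_)
  · refine (card_support_expand_le (pow_pos hp.pos _) _).trans ((card_support_X_sub_C_pow_le _ _).trans ?_)
    rw [Nat.sub_add_cancel (Nat.one_le_pow _ _ hp.pos)]
  · exact (card_support_expand_le (pow_pos hp.pos _) _).trans (card_support_X_sub_C_pow_le _ _)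

end Weight

end Polynomial

namespace PairCode

/-! ### The structure of `F[u, v] / ⟨u², v², uv - vu⟩` -/

section Ruv

variable {F : Type*} [Field F]

theorem u_mul_u : u F * u F = 0 := by
  rw [u, ← map_mul, Ideal.Quotient.eq_zero_iff_mem, ← pow_two]
  exact Ideal.subset_span (by simp)

theorem v_mul_v : v F * v F = 0 := by
  rw [v, ← map_mul, Ideal.Quotient.eq_zero_iff_mem, ← pow_two]
  exact Ideal.subset_span (by simp)

open DualNumber in
/-- The map to the dual numbers over the dual numbers over `F`. -/
noncomputable def toDual (F : Type*) [Field F] : Ruv F →ₐ[F] DualNumber (DualNumber F) :=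
  Ideal.Quotient.liftₐ _
    (MvPolynomial.aeval ![(TrivSqZeroExt.inr 1 : DualNumber (DualNumber F)),
      TrivSqZeroExt.inl (TrivSqZeroExt.inr 1)]) (by
    intro x hx
    rw [← RingHom.mem_ker]
    refine (Ideal.span_le.2 ?_) hx
    rintro y (rfl | rfl | rfl)
    · simp [RingHom.mem_ker, pow_two]
    · simp [RingHom.mem_ker, pow_two, ← TrivSqZeroExt.inl_mul]
    · simp [mul_comm])

theorem toDual_elt (a b c d : F) : toDual F (elt a b c d) =
    TrivSqZeroExt.inl (TrivSqZeroExt.inl a + TrivSqZeroExt.inr c) +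
      TrivSqZeroExt.inr (TrivSqZeroExt.inl b + TrivSqZeroExt.inr d) := by
  have hu : toDual F (u F) = TrivSqZeroExt.inr 1 := by
    change MvPolynomial.aeval _ (MvPolynomial.X 0) = _
    rw [MvPolynomial.aeval_X]; rfl
  have hv : toDual F (v F) = TrivSqZeroExt.inl (TrivSqZeroExt.inr 1) := by
    change MvPolynomial.aeval _ (MvPolynomial.X 1) = _
    rw [MvPolynomial.aeval_X]; rfl
  have hc : ∀ r : F, algebraMap F (DualNumber (DualNumber F)) r =
      TrivSqZeroExt.inl (TrivSqZeroExt.inl r) := fun r => rfl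
  rw [elt]
  simp only [map_add, map_mul, AlgHom.commutes, hu, hv, hc]
  ext <;> simp

/-- Iterated dual numbers separate the four coefficients, so 1, u, v, uv are independent over F. -/
theorem elt_injective {a b c d a' b' c' d' : F} (h : elt a b c d = elt a' b' c' d') :
    a = a' ∧ b = b' ∧ c = c' ∧ d = d' := by
  have := congrArg (toDual F) h
  rw [toDual_elt, toDual_elt] at this
  exact ⟨by simpa using congrArg (fun x => x.fst.fst) this,
    by simpa using congrArg (fun x => x.snd.fst) this,
    by simpa using congrArg (fun x => x.fst.snd) this,
    by simpa using congrArg (fun x => x.snd.snd) this⟩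

theorem elt_add (a b c d a' b' c' d' : F) :
    elt a b c d + elt a' b' c' d' = elt (a + a') (b + b') (c + c') (d + d') := by
  simp only [elt, map_add]
  ring

theorem elt_mul (a b c d a' b' c' d' : F) :
    elt a b c d * elt a' b' c' d' =
      elt (a * a') (a * b' + b * a') (a * c' + c * a') (a * d' + d * a' + b * c' + c * b') := by
  simp only [elt, map_add, map_mul]
  linear_combination (algebraMap F (Ruv F) b + algebraMap F (Ruv F) d * v F) *
    (algebraMap F (Ruv F) b' + algebraMap F (Ruv F) d' * v F) * u_mul_u (F := F) +
    (algebraMap F (Ruv F) c + algebraMap F (Ruv F) d * u F) *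
    (algebraMap F (Ruv F) c' + algebraMap F (Ruv F) d' * u F) * v_mul_v (F := F) -
    (algebraMap F (Ruv F) d * algebraMap F (Ruv F) d' * u F * u F * v_mul_v (F := F))

theorem exists_elt (r : Ruv F) : ∃ a b c d : F, r = elt a b c d := by
  obtain ⟨f, rfl⟩ := Ideal.Quotient.mk_surjective r
  induction f using MvPolynomial.induction_on with
  | C x => exact ⟨x, 0, 0, 0, by simp only [elt, map_zero, zero_mul, add_zero]; rfl⟩
  | add f g hf hg =>
    obtain ⟨a, b, c, d, h⟩ := hf
    obtain ⟨a', b', c', d', h'⟩ := hg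
    exact ⟨_, _, _, _, by rw [map_add, h, h', elt_add]⟩
  | mul_X f i hf =>
    obtain ⟨a, b, c, d, h⟩ := hf
    rw [map_mul, h]
    fin_cases i
    · exact ⟨_, _, _, _, by
        rw [← elt_mul a b c d 0 1 0 0]; congr 1; simp [elt, u]⟩
    · exact ⟨_, _, _, _, by
        rw [← elt_mul a b c d 0 0 1 0]; congr 1; simp [elt, v]⟩

theorem u_eq_elt : u F = elt 0 1 0 0 := by simp [elt]

theorem elt_zero : elt (0 : F) 0 0 0 = 0 := by simp [elt]

theorem exists_eq_u_mul_of_u_mul_eq_zero {r : Ruv F} (h : u F * r = 0) : ∃ r', r = u F * r' := by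
  obtain ⟨a, b, c, d, rfl⟩ := exists_elt r
  rw [u_eq_elt, elt_mul, ← elt_zero] at h
  obtain ⟨-, h1, -, h2⟩ := elt_injective h
  obtain rfl : a = 0 := by simpa using h1
  obtain rfl : c = 0 := by simpa using h2
  exact ⟨elt b 0 d 0, by rw [u_eq_elt, elt_mul]; simp⟩

theorem algebraMap_mul_u_mul_v_eq_zero {c : F} (h : algebraMap F (Ruv F) c * (u F * v F) = 0) :
    c = 0 := by
  have : elt 0 0 0 c = elt 0 0 0 0 := by rw [elt_zero, ← h]; simp [elt]
  exact (elt_injective this).2.2.2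

theorem isSquare_elt {a b c d : F} (h2 : (2 : F) ≠ 0) (ha : a ≠ 0) (h : IsSquare a) :
    IsSquare (elt a b c d) := by
  obtain ⟨r, rfl⟩ := h
  have hr : r ≠ 0 := left_ne_zero_of_mul ha
  -- Solves 2rb' = b, 2rc' = c, 2rd' + 2b'c' = d, the coefficient equations of a square with leading
  -- part r².
  refine ⟨elt r (b / (2 * r)) (c / (2 * r)) ((d - b * c / (2 * r ^ 2)) / (2 * r)), ?_⟩
  rw [elt_mul]
  congr 1 <;> field_simp <;> ring

end Ruv

/-! ### Symbol-pair distances -/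

section Distance

variable {A : Type*} {n : ℕ}

theorem next_injective : Function.Injective (next : Fin n → Fin n) := by
  intro i j h
  have h1 : (i.1 + 1) % n = (j.1 + 1) % n := congrArg Fin.val h
  have h2 : i.1 ≡ j.1 [MOD n] := Nat.ModEq.add_right_cancel' 1 h1
  exact Fin.ext (Nat.ModEq.eq_of_lt_of_lt h2 i.2 j.2)

theorem next_mod_two (hn : 2 ∣ n) (i : Fin n) : (next i).1 % 2 = (i.1 + 1) % 2 :=
  Nat.mod_mod_of_dvd _ hn

theorem ncard_preimage_next (B : Set (Fin n)) : (next ⁻¹' B).ncard = B.ncard :=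
  Set.ncard_preimage_of_injective_subset_range next_injective
    (by rw [(Finite.surjective_of_injective next_injective).range_eq]; exact Set.subset_univ _)

/-- Each position of B is seen by two pairs, its own and its predecessor's; no two positions of B
share a pair. -/
theorem two_mul_ncard_le_pairDist {x y : Fin n → A} {B : Set (Fin n)} (h : ∀ i ∈ B, x i ≠ y i)
    (hB : ∀ i ∈ B, next i ∉ B) : 2 * B.ncard ≤ pairDist x y := by
  have hd : Disjoint B (next ⁻¹' B) := Set.disjoint_left.2 hB
  rw [two_mul]
  nth_rewrite 2 [← ncard_preimage_next B]
  rw [← Set.ncard_union_eq hd]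
  refine Set.ncard_le_ncard ?_
  rintro i (hi | hi) hcon
  · exact h i hi (congrArg Prod.fst hcon)
  · exact h _ hi (congrArg Prod.snd hcon)

theorem pairDist_le_two_mul_ncard (x y : Fin n → A) :
    pairDist x y ≤ 2 * {i | x i ≠ y i}.ncard := by
  rw [two_mul]
  nth_rewrite 2 [← ncard_preimage_next]
  refine (Set.ncard_le_ncard ?_).trans (Set.ncard_union_le _ _)
  intro i hi
  by_contra hcon
  rw [Set.mem_union, not_or] at hcon
  exact hi (Prod.ext (not_not.1 hcon.1) (not_not.1 hcon.2))

theorem two_le_pairDist (hn : 2 ≤ n) {x y : Fin n → A} (h : x ≠ y) : 2 ≤ pairDist x y := by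
  obtain ⟨i, hi⟩ := Function.ne_iff.1 h
  have := two_mul_ncard_le_pairDist (x := x) (y := y) (B := {i}) (by rintro j rfl; exact hi) (by
    rintro j rfl hcon
    have h1 : (j.1 + 1) % n = j.1 := congrArg Fin.val (Set.mem_singleton_iff.1 hcon)
    have := j.2
    rcases Nat.lt_or_ge (j.1 + 1) n with h2 | h2
    · rw [Nat.mod_eq_of_lt h2] at h1
      omega
    · rw [show j.1 + 1 = n by omega, Nat.mod_self] at h1
      omega)
  simpa using this

theorem pairDist_le_pairDist {B : Type*} {x y : Fin n → A} {x' y' : Fin n → B}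
    (h : ∀ i, x i = y i → x' i = y' i) : pairDist x' y' ≤ pairDist x y := by
  refine Set.ncard_le_ncard fun i hi hcon => hi ?_
  exact Prod.ext (h _ (congrArg Prod.fst hcon)) (h _ (congrArg Prod.snd hcon))

theorem pairDist_sub [AddGroup A] (x y : Fin n → A) : pairDist (x - y) 0 = pairDist x y := by
  refine le_antisymm (pairDist_le_pairDist fun i h => ?_) (pairDist_le_pairDist fun i h => ?_)
  · rw [Pi.sub_apply, h, sub_self]; rfl
  · exact sub_eq_zero.1 h

/-- A lower bound for the pair weight of a word whose support contains that of a polynomial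
divisible by `(x ^ 2 - b) ^ j`. -/
theorem le_pairDist_of_pow_dvd {F : Type*} [Field F] {p : ℕ} [Fact p.Prime] [CharP F p] {b : F}
    (hb : b ≠ 0) {γ s Γ j : ℕ} (hγ : γ < s) (hΓ : 1 ≤ Γ)
    (hj : p ^ s + (Γ - 1) * p ^ (s - γ - 1) < j + p ^ (s - γ)) {g : F[X]} (hg : g ≠ 0)
    (hd : g.natDegree < 2 * p ^ s) (h : (X ^ 2 - C b) ^ j ∣ g) [Zero A]
    {c : Fin (2 * p ^ s) → A} (hc : ∀ i, c i = 0 → g.coeff i = 0) :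
    2 * (Γ + 1) * p ^ γ ≤ pairDist c 0 := by
  have hp : p.Prime := Fact.out
  have hexp : expand F 2 ((X - C b) ^ j) ∣ g := by
    rwa [map_pow, map_sub, expand_X, expand_C]
  obtain ⟨r, hr, hr0⟩ := exists_block_ne_zero two_pos hg
  have hdeg := natDegree_block_lt (r := r) two_pos (pow_pos hp.pos s) (by rwa [mul_comm] at hd)
  have hle := le_card_support_of_X_sub_C_pow_dvd hb hγ hΓ hr0 hdeg
    (dvd_block_of_expand_dvd two_pos hexp hr) hj
  -- Only one parity class is kept. As the length is even, parity alternates also across the cyclic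
  -- wrap, so B has no adjacent positions.
  set B : Set (Fin (2 * p ^ s)) := {i | i.1 % 2 = r ∧ g.coeff i ≠ 0} with hB
  have hBcard : (block 2 r g).support.card ≤ B.ncard := by
    rw [← Set.ncard_image_of_injective B Fin.val_injective,
      ← Set.ncard_coe_finset,
      ← Set.ncard_image_of_injective _ (f := fun k => k * 2 + r) (fun k l h => by
        simp only at h; omega)]
    refine Set.ncard_le_ncard ?_ (Set.toFinite _)
    rintro _ ⟨k, hk, rfl⟩
    rw [Finset.mem_coe, mem_support_iff, coeff_block two_ne_zero] at hk
    have hlt : k * 2 + r < 2 * p ^ s := by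
      by_contra! hcon
      exact hk (coeff_eq_zero_of_natDegree_lt (by omega))
    exact ⟨⟨_, hlt⟩, ⟨by simp only; omega, hk⟩, rfl⟩
  have := two_mul_ncard_le_pairDist (x := c) (y := 0) (B := B) (fun i hi h0 => hi.2 (hc i h0)) (by
    intro i hi hn
    have h1 := next_mod_two (dvd_mul_right 2 (p ^ s)) i
    have h2 := hi.1
    have h3 := hn.1
    omega)
  rw [mul_assoc]
  omega

end Distance

/-! ### Words and classes of polynomials -/

section Word

variable {R : Type*} [CommRing R] {n : ℕ} {a : R}

/-- The class of the polynomial with a given word of coefficients. -/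
noncomputable def word (n : ℕ) (a : R) : (Fin n → R) →+ Ambient n a where
  toFun c := ∑ i : Fin n, const n a (c i) * xbar n a ^ (i : ℕ)
  map_zero' := by simp
  map_add' c d := by simp [add_mul, Finset.sum_add_distrib]

theorem word_apply (c : Fin n → R) :
    word n a c = ∑ i : Fin n, const n a (c i) * xbar n a ^ (i : ℕ) := rfl

theorem mem_codeOf {I : Ideal (Ambient n a)} {c : Fin n → R} : c ∈ codeOf I ↔ word n a c ∈ I :=
  Iff.rfl

theorem const_mul_word (r : R) (c : Fin n → R) :
    const n a r * word n a c = word n a (fun i => r * c i) := by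
  rw [word_apply, word_apply, Finset.mul_sum]
  refine Finset.sum_congr rfl fun i _ => ?_
  rw [const, const, const, map_mul, mul_assoc]

theorem word_injective [Nontrivial R] (hn : n ≠ 0) : Function.Injective (word n a) := by
  rw [injective_iff_map_eq_zero]
  intro c hc
  have hm : (X ^ n - C a : R[X]).Monic := monic_X_pow_sub_C a hn
  set f : R[X] := ∑ i : Fin n, C (c i) * X ^ (i : ℕ) with hf
  have h1 : AdjoinRoot.mk (X ^ n - C a) f = 0 := by
    rw [← hc, word_apply, hf, map_sum]
    refine Finset.sum_congr rfl fun i _ => ?_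
    rw [map_mul, map_pow, AdjoinRoot.mk_C, AdjoinRoot.mk_X]
  have h2 : f = 0 := by
    by_contra h0
    refine AdjoinRoot.mk_ne_zero_of_degree_lt hm h0 ?_ h1
    rw [degree_X_pow_sub_C (Nat.pos_of_ne_zero hn)]
    exact degree_sum_fin_lt c
  funext i
  have h3 : f.coeff i = c i := by
    rw [hf, finsetSum_coeff, Finset.sum_eq_single i]
    · rw [coeff_C_mul_X_pow, if_pos rfl]
    · intro j _ hj
      rw [coeff_C_mul_X_pow, if_neg (fun h => hj (Fin.ext h.symm))]
    · intro h
      exact absurd (Finset.mem_univ i) h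
  rw [← h3, h2, coeff_zero, Pi.zero_apply]

theorem word_surjective [Nontrivial R] (hn : n ≠ 0) : Function.Surjective (word n a) := by
  intro y
  obtain ⟨g, rfl⟩ := AdjoinRoot.mk_surjective y
  have hm : (X ^ n - C a : R[X]).Monic := monic_X_pow_sub_C a hn
  have hd : (g %ₘ (X ^ n - C a)).natDegree < n := by
    have := natDegree_modByMonic_lt g hm (fun h => hn (by
      have := congrArg natDegree h
      rwa [natDegree_X_pow_sub_C, natDegree_one] at this))
    rwa [natDegree_X_pow_sub_C] at this
  have h1 : AdjoinRoot.mk (X ^ n - C a) g = AdjoinRoot.mk _ (g %ₘ (X ^ n - C a)) := by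
    rw [AdjoinRoot.mk_eq_mk]
    exact ⟨g /ₘ (X ^ n - C a), by
      rw [sub_eq_iff_eq_add, add_comm]
      exact (modByMonic_add_div g (X ^ n - C a)).symm⟩
  rw [h1]
  generalize g %ₘ (X ^ n - C a) = r at hd
  refine ⟨fun i => r.coeff i, ?_⟩
  conv_rhs => rw [as_sum_range_C_mul_X_pow' r hd]
  rw [map_sum, word_apply, Finset.sum_range]
  refine Finset.sum_congr rfl fun i _ => ?_
  rw [map_mul, map_pow, AdjoinRoot.mk_C, AdjoinRoot.mk_X]

theorem codePairDist_codeOf (I : Ideal (Ambient n a)) :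
    codePairDist (codeOf I) = sInf {d | ∃ c : Fin n → R, word n a c ∈ I ∧ c ≠ 0 ∧
      d = pairDist c 0} := by
  unfold codePairDist
  congr 1
  ext d
  constructor
  · rintro ⟨x, hx, y, hy, hxy, rfl⟩
    refine ⟨x - y, ?_, sub_ne_zero.2 hxy, (pairDist_sub x y).symm⟩
    rw [map_sub]
    exact I.sub_mem hx hy
  · rintro ⟨c, hc, hc0, rfl⟩
    exact ⟨c, hc, 0, by rw [mem_codeOf, map_zero]; exact I.zero_mem, hc0, rfl⟩

theorem codePairDist_codeOf_eq {I : Ideal (Ambient n a)} {d : ℕ}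
    (hle : ∀ c : Fin n → R, word n a c ∈ I → c ≠ 0 → d ≤ pairDist c 0)
    (hex : ∃ c : Fin n → R, word n a c ∈ I ∧ c ≠ 0 ∧ pairDist c 0 ≤ d) :
    codePairDist (codeOf I) = d := by
  rw [codePairDist_codeOf]
  obtain ⟨c, hc, hc0, hcd⟩ := hex
  refine le_antisymm (le_trans (Nat.sInf_le ?_) hcd)
    (le_csInf (Set.nonempty_of_mem (x := pairDist c 0) ?_) ?_)
  · exact ⟨c, hc, hc0, rfl⟩
  · exact ⟨c, hc, hc0, rfl⟩
  rintro _ ⟨c, hc, hc0, rfl⟩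
  exact hle c hc hc0

theorem codePairDist_codeOf_eq_of_le {I J : Ideal (Ambient n a)} (hJI : J ≤ I)
    (h : ∀ c : Fin n → R, word n a c ∈ I → c ≠ 0 →
      ∃ c' : Fin n → R, word n a c' ∈ J ∧ c' ≠ 0 ∧ pairDist c' 0 ≤ pairDist c 0) :
    codePairDist (codeOf I) = codePairDist (codeOf J) := by
  by_cases hne : ∃ c : Fin n → R, word n a c ∈ J ∧ c ≠ 0
  · obtain ⟨c₀, hc₀, hc₀'⟩ := hne
    rw [codePairDist_codeOf J]
    obtain ⟨c, hc, hc0, hd⟩ := Nat.sInf_mem (s := {d | ∃ c : Fin n → R, word n a c ∈ J ∧ c ≠ 0 ∧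
      d = pairDist c 0}) ⟨_, c₀, hc₀, hc₀', rfl⟩
    refine codePairDist_codeOf_eq (fun e he he0 => ?_) ⟨c, hJI hc, hc0, hd.ge⟩
    obtain ⟨e', he', he0', hle⟩ := h e he he0
    refine le_trans (Nat.sInf_le ?_) hle
    exact ⟨e', he', he0', rfl⟩
  -- Without nonzero words in J there are none in I, and both weight sets are empty.
  · rw [codePairDist_codeOf, codePairDist_codeOf]
    congr 1
    ext d
    constructor
    · rintro ⟨c, hc, hc0, -⟩
      obtain ⟨c', hc', hc0', -⟩ := h c hc hc0
      exact absurd ⟨c', hc', hc0'⟩ hne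
    · rintro ⟨c, hc, hc0, -⟩
      exact absurd ⟨c, hc, hc0⟩ hne

end Word

/-! ### The ring `R[x] / ⟨x ^ (2 p ^ s) - α⟩` -/

section Structure

variable {F : Type*} [Field F] {n : ℕ} {a : Ruv F}

instance : Nontrivial (Ruv F) :=
  ⟨0, u F, fun h => by
    rw [← elt_zero, u_eq_elt] at h
    exact zero_ne_one (elt_injective h).2.1⟩

theorem const_u_sq : const n a (u F) * const n a (u F) = 0 := by
  rw [const, ← map_mul, u_mul_u, map_zero]

theorem const_v_sq : const n a (v F) * const n a (v F) = 0 := by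
  rw [const, ← map_mul, v_mul_v, map_zero]

theorem const_elt (b c d e : F) : const n a (elt b c d e) =
    algebraMap F (Ambient n a) b + algebraMap F (Ambient n a) c * const n a (u F) +
      algebraMap F (Ambient n a) d * const n a (v F) +
      algebraMap F (Ambient n a) e * (const n a (u F) * const n a (v F)) := by
  simp only [elt, const, map_add, map_mul]
  rfl

theorem w_pow_eq_aeval (b : F) (k : ℕ) :
    w n a b ^ k = aeval (xbar n a) ((X ^ 2 - C b) ^ k) := by
  rw [map_pow, map_sub, map_pow, aeval_X, aeval_C]
  rfl

theorem xbar_pow : xbar n a ^ n = const n a a := by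
  have := AdjoinRoot.mk_self (f := X ^ n - C a)
  rw [map_sub, map_pow, AdjoinRoot.mk_C, AdjoinRoot.mk_X, sub_eq_zero] at this
  exact this

theorem exists_eq_const_u_mul (hn : n ≠ 0) {y : Ambient n a} (h : const n a (u F) * y = 0) :
    ∃ y', y = const n a (u F) * y' := by
  obtain ⟨c, rfl⟩ := word_surjective hn y
  rw [const_mul_word, ← map_zero (word n a)] at h
  have h1 := word_injective hn h
  choose d hd using fun i => exists_eq_u_mul_of_u_mul_eq_zero (congrFun h1 i)
  exact ⟨word n a d, by rw [const_mul_word]; exact congrArg _ (funext hd)⟩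

theorem exists_eq_aeval_add (hn : n ≠ 0) (y : Ambient n a) : ∃ (f : F[X]) (y₁ y₂ : Ambient n a),
    y = aeval (xbar n a) f + const n a (u F) * y₁ + const n a (v F) * y₂ := by
  obtain ⟨c, rfl⟩ := word_surjective hn y
  choose b₁ b₂ b₃ b₄ hb using fun i => exists_elt (c i)
  refine ⟨∑ i, C (b₁ i) * X ^ (i : ℕ),
    ∑ i, (algebraMap F (Ambient n a) (b₂ i) + algebraMap F (Ambient n a) (b₄ i) * const n a (v F)) *
      xbar n a ^ (i : ℕ),
    ∑ i, algebraMap F (Ambient n a) (b₃ i) * xbar n a ^ (i : ℕ), ?_⟩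
  rw [word_apply, map_sum, Finset.mul_sum, Finset.mul_sum, ← Finset.sum_add_distrib,
    ← Finset.sum_add_distrib]
  refine Finset.sum_congr rfl fun i _ => ?_
  rw [hb, const_elt, map_mul, map_pow, aeval_X, aeval_C]
  ring

theorem word_coeff_mul_u_mul_v {g : F[X]} (hg : g.natDegree < n) :
    word n a (fun i => algebraMap F (Ruv F) (g.coeff i) * (u F * v F)) =
      const n a (u F) * const n a (v F) * aeval (xbar n a) g := by
  conv_rhs => rw [as_sum_range_C_mul_X_pow' g hg]
  rw [map_sum, word_apply, Finset.sum_range, Finset.mul_sum]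
  refine Finset.sum_congr rfl fun i _ => ?_
  rw [map_mul, map_pow, aeval_X, aeval_C, const, map_mul, map_mul, AdjoinRoot.algebraMap_eq' F]
  change const n a (algebraMap F (Ruv F) (g.coeff i)) * (const n a (u F) * const n a (v F)) * _ =
    const n a (u F) * const n a (v F) * (const n a (algebraMap F (Ruv F) (g.coeff i)) * _)
  ring

/-- The relations between `x ^ 2 - b`, `u` and `v` in `R[x] / ⟨x ^ (2 p ^ s) - α⟩`, and
`x ^ 2 - b` being irreducible over `F`. -/
structure Relations (n q : ℕ) (α₁ α₂ α₃ α₄ b : F) : Prop where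
  pos : 0 < q
  length_eq : n = 2 * q
  pow_eq : (X ^ 2 - C b) ^ q = X ^ (2 * q) - C α₁
  irreducible : Irreducible (X ^ 2 - C b)
  ne_zero : α₃ ≠ 0

variable {q : ℕ} {α₁ α₂ α₃ α₄ b : F}

theorem Relations.length_ne_zero (H : Relations n q α₁ α₂ α₃ α₄ b) : n ≠ 0 := by
  have := H.pos
  have := H.length_eq
  omega

theorem Relations.w_pow (H : Relations n q α₁ α₂ α₃ α₄ b) : w n (elt α₁ α₂ α₃ α₄) b ^ q =
    algebraMap F _ α₂ * const n _ (u F) + algebraMap F _ α₃ * const n _ (v F) +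
      algebraMap F _ α₄ * (const n _ (u F) * const n _ (v F)) := by
  rw [w_pow_eq_aeval, H.pow_eq, map_sub, map_pow, aeval_X, aeval_C, ← H.length_eq, xbar_pow,
    const_elt]
  ring

theorem Relations.u_mul_w_pow (H : Relations n q α₁ α₂ α₃ α₄ b) (k : ℕ) :
    uw n (elt α₁ α₂ α₃ α₄) b (q + k) =
      algebraMap F _ α₃ * (const n _ (u F) * const n _ (v F) * w n _ b ^ k) := by
  have := const_u_sq (n := n) (a := elt α₁ α₂ α₃ α₄)
  rw [uw, pow_add, H.w_pow]
  linear_combination (algebraMap F (Ambient n (elt α₁ α₂ α₃ α₄)) α₂ +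
    algebraMap F (Ambient n (elt α₁ α₂ α₃ α₄)) α₄ * const n _ (v F)) * w n _ b ^ k * this

theorem Relations.u_mul_v_mul_w_pow (H : Relations n q α₁ α₂ α₃ α₄ b) :
    const n (elt α₁ α₂ α₃ α₄) (u F) * const n _ (v F) * w n _ b ^ q = 0 := by
  have h1 := const_u_sq (n := n) (a := elt α₁ α₂ α₃ α₄)
  have h2 := const_v_sq (n := n) (a := elt α₁ α₂ α₃ α₄)
  rw [H.w_pow]
  linear_combination (algebraMap F (Ambient n (elt α₁ α₂ α₃ α₄)) α₂ * const n _ (v F) +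
    algebraMap F (Ambient n (elt α₁ α₂ α₃ α₄)) α₄ * const n _ (v F) * const n _ (v F)) * h1 +
    algebraMap F (Ambient n (elt α₁ α₂ α₃ α₄)) α₃ * const n _ (u F) * h2

theorem Relations.uw_two_mul (H : Relations n q α₁ α₂ α₃ α₄ b) : uw n (elt α₁ α₂ α₃ α₄) b (q + q) = 0 := by
  rw [H.u_mul_w_pow, H.u_mul_v_mul_w_pow, mul_zero]

/-! ### Locality of the ambient ring and the chain of multiples of u -/

theorem isNilpotent_const_u : IsNilpotent (const n a (u F)) := ⟨2, (pow_two _).trans const_u_sq⟩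

theorem isNilpotent_const_v : IsNilpotent (const n a (v F)) := ⟨2, (pow_two _).trans const_v_sq⟩

theorem Relations.isNilpotent_w (H : Relations n q α₁ α₂ α₃ α₄ b) :
    IsNilpotent (w n (elt α₁ α₂ α₃ α₄) b) := by
  refine IsNilpotent.of_pow (m := q) ?_
  rw [← mem_nilradical, H.w_pow]
  have h1 : const n (elt α₁ α₂ α₃ α₄) (u F) ∈ nilradical _ := isNilpotent_const_u
  have h2 : const n (elt α₁ α₂ α₃ α₄) (v F) ∈ nilradical _ := isNilpotent_const_v
  exact add_mem (add_mem (Ideal.mul_mem_left _ _ h1) (Ideal.mul_mem_left _ _ h2))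
    (Ideal.mul_mem_left _ _ (Ideal.mul_mem_left _ _ h2))

/-- If x² - b does not divide f, Bézout and the nilpotency of w make f(x) a unit, and the terms in u
and v are nilpotent. Otherwise w divides f(x). -/
theorem Relations.isUnit_or (H : Relations n q α₁ α₂ α₃ α₄ b) (y : Ambient n (elt α₁ α₂ α₃ α₄)) :
    IsUnit y ∨ ∃ y₁ y₂, y = const n _ (u F) * y₁ + w n _ b * y₂ := by
  obtain ⟨f, y₁, y₂, hy⟩ := exists_eq_aeval_add H.length_ne_zero y
  rcases H.irreducible.isCoprime_or_dvd f with hf | ⟨k, hk⟩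
  · left
    obtain ⟨c, d, hcd⟩ := hf
    have h1 := congrArg (aeval (xbar n (elt α₁ α₂ α₃ α₄))) hcd
    have h2 := w_pow_eq_aeval (n := n) (a := elt α₁ α₂ α₃ α₄) b 1
    rw [pow_one, pow_one] at h2
    rw [map_add, map_mul, map_mul, map_one, ← h2] at h1
    have h3 : IsUnit (aeval (xbar n (elt α₁ α₂ α₃ α₄)) d * aeval (xbar n _) f) := by
      rw [← eq_sub_iff_add_eq'] at h1
      rw [h1]
      exact IsNilpotent.isUnit_one_sub ((Commute.all _ _).isNilpotent_mul_left H.isNilpotent_w)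
    rw [hy, add_assoc]
    refine IsNilpotent.isUnit_add_left_of_commute ?_ (isUnit_of_mul_isUnit_right h3)
      (Commute.all _ _)
    have h4 : const n (elt α₁ α₂ α₃ α₄) (u F) ∈ nilradical _ := isNilpotent_const_u
    have h5 : const n (elt α₁ α₂ α₃ α₄) (v F) ∈ nilradical _ := isNilpotent_const_v
    exact add_mem (Ideal.mul_mem_right _ _ h4) (Ideal.mul_mem_right _ _ h5)
  · right
    obtain ⟨r, hr⟩ := Nat.exists_eq_succ_of_ne_zero H.pos.ne'
    have h1 := H.w_pow
    have h2 := w_pow_eq_aeval (n := n) (a := elt α₁ α₂ α₃ α₄) b 1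
    rw [pow_one, pow_one] at h2
    have h3 : algebraMap F (Ambient n (elt α₁ α₂ α₃ α₄)) α₃ * algebraMap F _ α₃⁻¹ = 1 := by
      rw [← map_mul, mul_inv_cancel₀ H.ne_zero, map_one]
    rw [hr, Nat.succ_eq_add_one, pow_add (w n _ b) r 1, pow_one (w n _ b)] at h1
    -- Substitutes v = α₃⁻¹(w^q - α₂u - α₄uv), with q = r + 1.
    refine ⟨y₁ - algebraMap F _ α₃⁻¹ * (algebraMap F _ α₂ + algebraMap F _ α₄ * const n _ (v F)) *
      y₂, aeval (xbar n _) k + algebraMap F _ α₃⁻¹ * w n _ b ^ r * y₂, ?_⟩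
    rw [hy, hk, map_mul, ← h2]
    linear_combination -(algebraMap F (Ambient n (elt α₁ α₂ α₃ α₄)) α₃⁻¹ * y₂) * h1 -
      const n _ (v F) * y₂ * h3

/-- As long as the cofactor is not a unit, u² = 0 lets one more factor w be extracted; u w^(2q) = 0
stops the process. -/
theorem Relations.u_mul_eq (H : Relations n q α₁ α₂ α₃ α₄ b) (y : Ambient n (elt α₁ α₂ α₃ α₄)) :
    const n _ (u F) * y = 0 ∨ ∃ k e, IsUnit e ∧ const n _ (u F) * y = uw n _ b k * e := by
  have key : ∀ N : ℕ, (∃ y', const n _ (u F) * y = uw n _ b N * y') ∨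
      ∃ k e, IsUnit e ∧ const n _ (u F) * y = uw n _ b k * e := by
    intro N
    induction N with
    | zero => exact Or.inl ⟨y, by rw [uw, pow_zero, mul_one]⟩
    | succ N ih =>
      rcases ih with ⟨y', hy'⟩ | h
      · rcases H.isUnit_or y' with h | ⟨y₁, y₂, h⟩
        · exact Or.inr ⟨N, y', h, hy'⟩
        · refine Or.inl ⟨y₂, ?_⟩
          rw [hy', h, uw, uw]
          have := const_u_sq (n := n) (a := elt α₁ α₂ α₃ α₄)
          linear_combination w n _ b ^ N * y₁ * this
      · exact Or.inr h
  rcases key (q + q) with ⟨y', hy'⟩ | h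
  · left
    rw [hy', H.uw_two_mul, zero_mul]
  · exact Or.inr h

/-! ### Reduction to the ideal generated by u(x² - b)^μ -/

theorem uw_mem_span_of_le {k l : ℕ} (h : k ≤ l) : uw n a b l ∈ Ideal.span {uw n a b k} := by
  obtain ⟨d, rfl⟩ := Nat.exists_eq_add_of_le h
  exact Ideal.mem_span_singleton.2 ⟨w n a b ^ d, by rw [uw, uw, pow_add, mul_assoc]⟩

theorem const_u_mul_gen (ℓ t : ℕ) (z : Ambient n a) :
    const n a (u F) * gen b ℓ t z = uw n a b ℓ := by
  have := const_u_sq (n := n) (a := a)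
  rw [gen, uw, uw]
  linear_combination w n a b ^ t * z * this

theorem torIndex_le (ℓ t : ℕ) (z : Ambient n a) : torIndex b ℓ t z ≤ ℓ := by
  refine Nat.sInf_le ?_
  change uw n a b ℓ ∈ Ideal.span {gen b ℓ t z}
  rw [← const_u_mul_gen ℓ t z]
  exact Ideal.mul_mem_left _ _ (Ideal.mem_span_singleton_self _)

/-- The annihilator of u is generated by u, so the multiple of `gen` in y is 0 or u w^k times a
unit. In the latter case u w^k lies in the ideal of `gen`, so k is at least the torsion index, hence
at least μ. -/
theorem Relations.mem_span_uw_of_u_mul_eq_zero (H : Relations n q α₁ α₂ α₃ α₄ b) {ℓ t μ : ℕ}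
    {z : Ambient n (elt α₁ α₂ α₃ α₄)} (hμ : μ ≤ torIndex b ℓ t z)
    {y : Ambient n (elt α₁ α₂ α₃ α₄)} (hy : y ∈ typeD b ℓ t μ z)
    (h0 : const n _ (u F) * y = 0) : y ∈ Ideal.span {uw n (elt α₁ α₂ α₃ α₄) b μ} := by
  obtain ⟨f, g, rfl⟩ := Ideal.mem_span_pair.1 hy
  refine add_mem ?_ (Ideal.mul_mem_left _ _ (Ideal.mem_span_singleton_self _))
  have h1 : const n _ (u F) * (f * gen b ℓ t z) = 0 := by
    have := const_u_sq (n := n) (a := elt α₁ α₂ α₃ α₄)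
    rw [mul_add, uw] at h0
    linear_combination h0 - g * w n _ b ^ μ * this
  obtain ⟨y', hy'⟩ := exists_eq_const_u_mul H.length_ne_zero h1
  rw [hy']
  rcases H.u_mul_eq y' with h2 | ⟨k, e, he, h2⟩
  · rw [h2]
    exact zero_mem _
  · have hk : torIndex b ℓ t z ≤ k := by
      refine Nat.sInf_le ?_
      change uw n _ b k ∈ Ideal.span {gen b ℓ t z}
      obtain ⟨e', rfl⟩ := he
      have h3 : uw n _ b k = ((e'⁻¹ : (Ambient n (elt α₁ α₂ α₃ α₄))ˣ) : Ambient n (elt α₁ α₂ α₃ α₄)) * f *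
          gen b ℓ t z := by
        rw [mul_assoc, hy', h2, mul_left_comm, Units.inv_mul, mul_one]
      rw [h3]
      exact Ideal.mul_mem_left _ _ (Ideal.mem_span_singleton_self _)
    rw [h2]
    exact Ideal.mul_mem_right _ _ (uw_mem_span_of_le (hμ.trans hk))

theorem Relations.codePairDist_typeD (H : Relations n q α₁ α₂ α₃ α₄ b) {ℓ t μ : ℕ}
    {z : Ambient n (elt α₁ α₂ α₃ α₄)} (hμ : μ ≤ torIndex b ℓ t z) :
    codePairDist (codeOf (typeD b ℓ t μ z)) =
      codePairDist (codeOf (Ideal.span {uw n (elt α₁ α₂ α₃ α₄) b μ})) := by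
  refine codePairDist_codeOf_eq_of_le (Ideal.span_mono (by simp)) fun c hc hc0 => ?_
  by_cases h0 : const n _ (u F) * word n (elt α₁ α₂ α₃ α₄) c = 0
  · exact ⟨c, H.mem_span_uw_of_u_mul_eq_zero hμ hc h0, hc0, le_rfl⟩
  · refine ⟨fun i => u F * c i, ?_, ?_, pairDist_le_pairDist fun i hi => ?_⟩
    · rw [← const_mul_word]
      obtain ⟨f, g, hfg⟩ := Ideal.mem_span_pair.1 hc
      have h1 : const n _ (u F) * word n (elt α₁ α₂ α₃ α₄) c = f * uw n _ b ℓ := by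
        have := const_u_sq (n := n) (a := elt α₁ α₂ α₃ α₄)
        rw [← hfg, ← const_u_mul_gen ℓ t z, uw]
        linear_combination g * w n _ b ^ μ * this
      rw [h1]
      exact Ideal.mul_mem_left _ _ (uw_mem_span_of_le (hμ.trans (torIndex_le ℓ t z)))
    · intro h
      rw [const_mul_word, h, map_zero] at h0
      exact h0 rfl
    · exact (congrArg (u F * ·) hi).trans (mul_zero _)

/-! ### The pair distance of the ideal generated by u(x² - b)^μ -/

theorem Relations.const_u_mul_const_v_mul_w_pow_mem (H : Relations n q α₁ α₂ α₃ α₄ b) {μ k : ℕ}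
    (h : μ ≤ q + k) : const n _ (u F) * const n _ (v F) * w n _ b ^ k ∈
      Ideal.span {uw n (elt α₁ α₂ α₃ α₄) b μ} := by
  have h1 := Ideal.mul_mem_left _ (algebraMap F _ α₃⁻¹)
    (uw_mem_span_of_le (n := n) (a := elt α₁ α₂ α₃ α₄) (b := b) h)
  rwa [H.u_mul_w_pow, ← mul_assoc, ← map_mul, inv_mul_cancel₀ H.ne_zero, map_one, one_mul] at h1

/-- Every codeword of `⟨u (x ^ 2 - b) ^ (q + j)⟩` is `u v` times a word over `F`. -/
theorem Relations.exists_polynomial (H : Relations n q α₁ α₂ α₃ α₄ b) {j : ℕ} (hj : j ≤ q) {c : Fin n → Ruv F}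
    (hc : word n (elt α₁ α₂ α₃ α₄) c ∈ Ideal.span {uw n (elt α₁ α₂ α₃ α₄) b (q + j)}) :
    ∃ g : F[X], g.natDegree < n ∧ (X ^ 2 - C b) ^ j ∣ g ∧
      c = fun i : Fin n => algebraMap F (Ruv F) (g.coeff i) * (u F * v F) := by
  obtain ⟨y, hy⟩ := Ideal.mem_span_singleton.1 hc
  obtain ⟨f, y₁, y₂, rfl⟩ := exists_eq_aeval_add H.length_ne_zero y
  have hm : (X ^ n - C α₁ : F[X]).Monic := monic_X_pow_sub_C α₁ H.length_ne_zero
  have hmod : (X ^ n - C α₁ : F[X]) = (X ^ 2 - C b) ^ q := by rw [H.pow_eq, H.length_eq]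
  -- Under the factor uv the relation x^n = α becomes x^n = α₁. Reducing modulo x^n - α₁ = (x² -
  -- b)^q keeps divisibility by (x² - b)^j because j ≤ q.
  set f' : F[X] := C α₃ * (X ^ 2 - C b) ^ j * f with hf'
  have hdm := modByMonic_add_div f' (X ^ n - C α₁)
  have hd : (f' %ₘ (X ^ n - C α₁)).natDegree < n := by
    have := natDegree_modByMonic_lt f' hm (fun h => H.length_ne_zero (by
      have := congrArg natDegree h
      rwa [natDegree_X_pow_sub_C, natDegree_one] at this))
    rwa [natDegree_X_pow_sub_C] at this
  refine ⟨f' %ₘ (X ^ n - C α₁), hd, ?_, word_injective H.length_ne_zero (a := elt α₁ α₂ α₃ α₄) ?_⟩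
  · rw [← eq_sub_iff_add_eq] at hdm
    rw [hdm]
    refine dvd_sub (Dvd.dvd.mul_right (dvd_mul_left _ _) _) (Dvd.dvd.mul_right ?_ _)
    rw [hmod]
    exact pow_dvd_pow _ hj
  · rw [word_coeff_mul_u_mul_v hd, hy, H.u_mul_w_pow]
    have h1 := const_u_sq (n := n) (a := elt α₁ α₂ α₃ α₄)
    have h2 := const_v_sq (n := n) (a := elt α₁ α₂ α₃ α₄)
    have h3 := congrArg (aeval (xbar n (elt α₁ α₂ α₃ α₄))) hdm
    rw [map_add, map_mul, hmod, ← w_pow_eq_aeval, hf', map_mul, map_mul, ← w_pow_eq_aeval,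
      aeval_C, ← hmod, ← hf'] at h3
    have h4 := H.u_mul_v_mul_w_pow
    linear_combination algebraMap F (Ambient n (elt α₁ α₂ α₃ α₄)) α₃ * w n _ b ^ j *
      (const n _ (v F) * y₁ * h1 + const n _ (u F) * y₂ * h2) -
      const n _ (u F) * const n _ (v F) * h3 +
      aeval (xbar n (elt α₁ α₂ α₃ α₄)) (f' /ₘ (X ^ n - C α₁)) * h4

theorem word_coeff_ne_zero {g : F[X]} (hg0 : g ≠ 0) (hg : g.natDegree < n) :
    (fun i : Fin n => algebraMap F (Ruv F) (g.coeff i) * (u F * v F)) ≠ 0 := by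
  intro h
  have := congrFun h ⟨g.natDegree, hg⟩
  exact hg0 (leadingCoeff_eq_zero.1 (algebraMap_mul_u_mul_v_eq_zero this))

theorem pairDist_word_coeff_le (g : F[X]) :
    pairDist (fun i : Fin n => algebraMap F (Ruv F) (g.coeff i) * (u F * v F)) 0 ≤
      2 * g.support.card := by
  refine (pairDist_le_two_mul_ncard _ _).trans (Nat.mul_le_mul_left _ ?_)
  rw [← Set.ncard_coe_finset]
  refine Set.ncard_le_ncard_of_injOn Fin.val (fun i hi => ?_) Fin.val_injective.injOn
    (Set.toFinite _)
  rw [Finset.mem_coe, mem_support_iff]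
  intro h0
  refine hi ?_
  simp only [h0, map_zero, zero_mul, Pi.zero_apply]

theorem Relations.codePairDist_span_uw_of_le (H : Relations n q α₁ α₂ α₃ α₄ b) {μ : ℕ} (hμ : μ ≤ q) :
    codePairDist (codeOf (Ideal.span {uw n (elt α₁ α₂ α₃ α₄) b μ})) = 2 := by
  have hn : 2 ≤ n := by
    have := H.pos
    have := H.length_eq
    omega
  have hd : (1 : F[X]).natDegree < n := by rw [natDegree_one]; omega
  refine codePairDist_codeOf_eq (fun c _ hc0 => two_le_pairDist hn hc0)
    ⟨_, ?_, word_coeff_ne_zero one_ne_zero hd, (pairDist_word_coeff_le 1).trans ?_⟩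
  · rw [word_coeff_mul_u_mul_v hd, map_one]
    simpa using H.const_u_mul_const_v_mul_w_pow_mem (k := 0) hμ
  · have := card_support_C_mul_X_pow_le_one (c := (1 : F)) (n := 0)
    rw [pow_zero, mul_one, C_1] at this
    omega

theorem Relations.codePairDist_span_uw {p s : ℕ} [Fact p.Prime] [CharP F p]
    (H : Relations (2 * p ^ s) (p ^ s) α₁ α₂ α₃ α₄ b) (hb : b ≠ 0) {Γ γ μ : ℕ} (hΓ : 1 ≤ Γ)
    (hΓp : Γ ≤ p - 1) (hγ : γ < s)
    (h1 : 2 * p ^ s - p ^ (s - γ) + (Γ - 1) * p ^ (s - γ - 1) + 1 ≤ μ)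
    (h2 : μ ≤ 2 * p ^ s - p ^ (s - γ) + Γ * p ^ (s - γ - 1)) :
    codePairDist (codeOf (Ideal.span {uw (2 * p ^ s) (elt α₁ α₂ α₃ α₄) b μ})) =
      2 * (Γ + 1) * p ^ γ := by
  have hp : p.Prime := Fact.out
  have hle : p ^ (s - γ) ≤ p ^ s := Nat.pow_le_pow_right hp.pos (Nat.sub_le _ _)
  have hlt : Γ * p ^ (s - γ - 1) < p ^ (s - γ) := by
    have e : s - γ = s - γ - 1 + 1 := by omega
    conv_rhs => rw [e, pow_succ']
    exact Nat.mul_lt_mul_of_pos_right (by have := hp.one_lt; omega) (pow_pos hp.pos _)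
  obtain ⟨j, rfl⟩ : ∃ j, μ = p ^ s + j := ⟨μ - p ^ s, by omega⟩
  -- p^s + J is the largest μ in the range, so uv(x² - b)^J lies in all these codes; Γ ≤ p - 1 gives
  -- J < p^s.
  set J := p ^ s - p ^ (s - γ) + Γ * p ^ (s - γ - 1) with hJ
  have hexp : (X ^ 2 - C b) ^ J = expand F 2 ((X - C b) ^ J) := by
    rw [map_pow, map_sub, expand_X, expand_C]
  have hd : ((X ^ 2 - C b) ^ J).natDegree < 2 * p ^ s := by
    rw [natDegree_pow, natDegree_X_pow_sub_C]
    omega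
  have h0 : (X ^ 2 - C b) ^ J ≠ 0 := pow_ne_zero _ H.irreducible.ne_zero
  refine codePairDist_codeOf_eq (fun c hc hc0 => ?_)
    ⟨_, ?_, word_coeff_ne_zero h0 hd, (pairDist_word_coeff_le _).trans ?_⟩
  · obtain ⟨g, hgd, hdvd, rfl⟩ := H.exists_polynomial (by omega) hc
    refine le_pairDist_of_pow_dvd hb hγ hΓ (j := j) (by omega) ?_ hgd hdvd
      fun i hi => algebraMap_mul_u_mul_v_eq_zero hi
    rintro rfl
    refine hc0 (funext fun i => ?_)
    simp only [coeff_zero, map_zero, zero_mul, Pi.zero_apply]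
  · rw [word_coeff_mul_u_mul_v hd, ← w_pow_eq_aeval]
    exact H.const_u_mul_const_v_mul_w_pow_mem (by omega)
  · rw [mul_assoc, hexp]
    exact Nat.mul_le_mul_left _ ((card_support_expand_le two_pos _).trans
      (card_support_X_sub_C_pow_le_mul b hγ))

end Structure

/-! ### The relations for α₀ -/

theorem alpha0_pow {F : Type*} [Field F] [Finite F] {p m s : ℕ} (hm : 0 < m)
    (hF : Nat.card F = p ^ m) (α₁ : F) : alpha0 p m s α₁ ^ p ^ s = α₁ := by
  have := Fintype.ofFinite F
  -- The total exponent of p is a multiple of m, and raising to the power p^m is the identity on F.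
  have hs : m - s % m + s = m * (s / m + 1) := by
    have h1 := Nat.mod_lt s hm
    have h2 := Nat.div_add_mod s m
    rw [Nat.mul_add, mul_one]
    omega
  rw [alpha0, ← pow_mul, ← pow_add, hs, pow_mul, ← hF, Nat.card_eq_fintype_card,
    FiniteField.pow_card_pow]

theorem relations_alpha0 {F : Type*} [Field F] [Finite F] {p m s : ℕ} [Fact p.Prime] [CharP F p]
    (hp2 : p ≠ 2) (hm : 0 < m) (hF : Nat.card F = p ^ m) {α₁ α₂ α₃ α₄ : F} (h1 : α₁ ≠ 0)
    (h3 : α₃ ≠ 0) (hsq : ¬ IsSquare (elt α₁ α₂ α₃ α₄)) :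
    Relations (2 * p ^ s) (p ^ s) α₁ α₂ α₃ α₄ (alpha0 p m s α₁) where
  pos := pow_pos (Fact.out : p.Prime).pos s
  length_eq := rfl
  pow_eq := by rw [sub_pow_char_pow, ← pow_mul, ← C_pow, alpha0_pow hm hF]
  irreducible := by
    refine X_pow_sub_C_irreducible_of_prime Nat.prime_two fun r hr => hsq ?_
    refine isSquare_elt (Ring.two_ne_zero (by rwa [ringChar.eq F p])) h1 ⟨r ^ p ^ s, ?_⟩
    rw [← alpha0_pow (s := s) hm hF α₁, ← hr, ← pow_mul, mul_comm 2, pow_mul, pow_two]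
  ne_zero := h3

end PairCode

theorem theorem14 {F : Type*} [Field F] [Finite F] (p m s : ℕ) (hp : p.Prime) (hp2 : p ≠ 2)
    (hm : 0 < m) (hs : 0 < s) (hF : Nat.card F = p ^ m)
    (α₁ α₂ α₃ α₄ : F) (h1 : α₁ ≠ 0) (h2 : α₂ ≠ 0) (h3 : α₃ ≠ 0)
    (hsq : ¬ IsSquare (PairCode.elt α₁ α₂ α₃ α₄))
    (ℓ t μ : ℕ) (hℓ : ℓ ≤ 2 * p ^ s - 1) (ht : t < ℓ)
    (z : PairCode.Ambient (2 * p ^ s) (PairCode.elt α₁ α₂ α₃ α₄))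
    (hz : z = 0 ∨ IsUnit z)
    (hμ : μ ≤ PairCode.torIndex (PairCode.alpha0 p m s α₁) ℓ t z) :
    PairCode.codePairDist
        (PairCode.codeOf (PairCode.typeD (PairCode.alpha0 p m s α₁) ℓ t μ z)) =
      PairCode.codePairDist
        (PairCode.codeOf (Ideal.span {PairCode.uw (2 * p ^ s) (PairCode.elt α₁ α₂ α₃ α₄)
          (PairCode.alpha0 p m s α₁) μ})) ∧
    (μ ≤ p ^ s →
      PairCode.codePairDist
        (PairCode.codeOf (PairCode.typeD (PairCode.alpha0 p m s α₁) ℓ t μ z)) = 2) ∧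
    (∀ Γ γ : ℕ, 1 ≤ Γ → Γ ≤ p - 1 → γ ≤ s - 1 →
      2 * p ^ s - p ^ (s - γ) + (Γ - 1) * p ^ (s - γ - 1) + 1 ≤ μ →
      μ ≤ 2 * p ^ s - p ^ (s - γ) + Γ * p ^ (s - γ - 1) →
      PairCode.codePairDist
        (PairCode.codeOf (PairCode.typeD (PairCode.alpha0 p m s α₁) ℓ t μ z)) =
          2 * (Γ + 1) * p ^ γ) := by
  have : Fact p.Prime := ⟨hp⟩
  have : Fintype F := Fintype.ofFinite F
  have : CharP F p := charP_of_card_eq_prime_pow (f := m) (by rw [← hF, Nat.card_eq_fintype_card])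
  have H := PairCode.relations_alpha0 (s := s) hp2 hm hF h1 h3 hsq
  have hb : PairCode.alpha0 p m s α₁ ≠ 0 := pow_ne_zero _ h1
  have hmain := H.codePairDist_typeD hμ
  refine ⟨hmain, fun h => hmain.trans (H.codePairDist_span_uw_of_le h), ?_⟩
  intro Γ γ hΓ hΓp hγ hle hge
  exact hmain.trans (H.codePairDist_span_uw hb hΓ hΓp (by omega) hle hge)
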